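/- **Theorem (Verifiable EFI pairs with VPRDM).** Let $0<c<\gamma<1$ be constants, and let $\lambda(n),m_0(n),m_1(n)$ be natural numbers ($n\in\mathbb N$) with $\lambda(n)=cn$ and $m_1(n)=\gamma n$ up to rounding to an integer (error at most $1$), and $m_0(n)=\mathrm{polylog}(n)$, i.e. $m_0(n)=O((\log n)^d)$ for some $d$. Here $\lambda$ is the security parameter and the key space is $\mathcal K=\{0,1\}^{\lambda}$. For $b\in\{0,1\}$ let $\{\rho_{b,k}\}_{k\in\mathcal K}$ be a VPRDM on $n$ qubits with mixedness parameter $m_b\le n$ whose states have the form $$\rho_{b,k}=U_{b,k}\bigl((|0\rangle\langle 0|)^{\otimes (n-m_b)}\otimes I/2^{m_b}\bigr)U_{b,k}^\dagger$$ with unitaries $U_{b,k}$. Then the two families form a verifiable EFI pair. That is, with the key averages $\nu_b=2^{-\lambda}\sum_{k}\rho_{b,k}$: 1. (efficient generation) there is a QPT algorithm that on input $b$ outputs $\nu_b$; 2. (statistically far) there is $d$ such that $\tfrac12\|\nu_0-\nu_1\|_1\ge \lambda^{-d}$ for all sufficiently large $n$; 3. (computational indistinguishability) $|\Pr[\mathcal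 A(\nu_0)=1]-\Pr[\mathcal A(\nu_1)=1]|=\mathrm{negl}(\lambda)$ for every QPT algorithm $\mathcal A$; 4. (verifiability) there is a QPT algorithm $\mathcal V$ such that for each $b$ one has, for all $k$, $\Pr[\mathcal V(\rho_{b,k},k,b)=1]=1$ and, with a negligible bound that is uniform in $k$, $\Pr_{k'\leftarrow\mathcal K\setminus\{k\}}[\mathcal V(\rho_{b,k},k',b)=1]=\mathrm{negl}(\lambda)$. Here a keyed family $\{\rho_k\}_{k\in\mathcal K}$ of $n$-qubit density matrices, with $\lambda=\mathrm{poly}(n)$, is a *VPRDM with mixedness parameter* $m=m(n)$ if (i) a QPT algorithm outputs exactly $\rho_k$ on input $k$; (ii) for all $t=\mathrm{poly}(n)$ and all QPT algorithms $\mathcal A$, $|\Pr_{k\leftarrow\mathcal K}[\mathcal A(\rho_k^{\otimes t})=1]-\Pr_{\rho\leftarrow\eta_{n,m}}[\mathcal A(\rho^{\otimes t})=1]|=\mathrm{negl}(\lambda)$, where $\eta_{n,m}$ is the ensemble of the partial traces over $m$ qubits of Haar random pure states of $n+m$ qubits; (iii) a QPT algorithm $\mathcal V$ satisfies $\Pr[\mathcal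 V(\rho_k,k)=1]=1$ for all $k$ and, with a negligible bound uniform in $k$, $\Pr_{k'\leftarrow\mathcal K\setminus\{k\}}[\mathcal V(\rho_k,k')=1]=\mathrm{negl}(\lambda)$. A *QPT algorithm* is a family of quantum circuits (gates $H$, $T$, CNOT, computational-basis measurements, ancillas in $|0\rangle$, discarding of qubits) that one classical algorithm writes down in polynomial time, given $n$ and $\lambda(n)$ in unary (and the bit $b$, in items 1 and 4 of the conclusion); quantum inputs and the key are supplied to the circuit. A function $f(n)$ is $\mathrm{negl}(\lambda)$ if for every $c'\in\mathbb N$, $|f(n)|<\lambda(n)^{-c'}$ for all sufficiently large $n$. -/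

import Mathlib

noncomputable section

namespace QPT

open scoped ComplexConjugate ComplexOrder
open MeasureTheory

/-! ### Qubits, density matrices, trace distance -/

/-- Bit strings of length `N`; they label the computational basis of `N` qubits. -/
abbrev Bits (N : ℕ) : Type := Fin N → Bool

/-- Operators on `N` qubits, in the computational basis. -/
abbrev QMat (N : ℕ) : Type := Matrix (Bits N) (Bits N) ℂ

def IsDensity {N : ℕ} (ρ : QMat N) : Prop := ρ.PosSemidef ∧ ρ.trace = 1

/-- The trace norm: the sum of the singular values, that is the trace of the square root
of `Aᴴ * A`. -/
def traceNorm {N : ℕ} (A : QMat N) : ℝ :=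
  ∑ i, Real.sqrt ((Matrix.posSemidef_conjTranspose_mul_self A).isHermitian.eigenvalues i)

def traceDist {N : ℕ} (ρ σ : QMat N) : ℝ := traceNorm (ρ - σ) / 2

/-- The basis state `|k⟩⟨k|`. -/
def ketbra {N : ℕ} (k : Bits N) : QMat N := fun x y => if x = k ∧ y = k then 1 else 0

/-- `ρ ⊗ σ`, with `ρ` on the first `a` qubits and `σ` on the following `b` qubits. -/
def tensor {a b : ℕ} (ρ : QMat a) (σ : QMat b) : QMat (a + b) := fun x y =>
  ρ (fun i => x (Fin.castAdd b i)) (fun i => y (Fin.castAdd b i)) *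
    σ (fun i => x (Fin.natAdd a i)) (fun i => y (Fin.natAdd a i))

/-- `t` copies of an `n`-qubit operator; copy `j` sits on the qubits `j * n, …, j * n + n - 1`. -/
def copies {n : ℕ} (t : ℕ) (ρ : QMat n) : QMat (t * n) := fun x y =>
  ∏ j : Fin t, ρ (fun i => x (finProdFinEquiv (j, i))) (fun i => y (finProdFinEquiv (j, i)))

/-! ### Quantum circuits -/

/-- The gates: Hadamard, `T = diag(1, exp(iπ/4))`, controlled not (control first), and
measurement of one qubit in the computational basis. The arguments are the addresses
of the qubits. -/
inductive Gate : Type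
  | had (i : ℕ)
  | tee (i : ℕ)
  | cnot (i j : ℕ)
  | meas (i : ℕ)

def Gate.map (f : ℕ → ℕ) : Gate → Gate
  | .had i => .had (f i)
  | .tee i => .tee (f i)
  | .cnot i j => .cnot (f i) (f j)
  | .meas i => .meas (f i)

/-- One more than the largest address that the gate uses. -/
def Gate.width : Gate → ℕ
  | .had i => i + 1
  | .tee i => i + 1
  | .cnot i j => max (i + 1) (j + 1)
  | .meas i => i + 1

def hadMat : Matrix Bool Bool ℂ := fun a b =>
  ((Real.sqrt 2 : ℝ) : ℂ)⁻¹ * (if a = true ∧ b = true then -1 else 1)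

def teeMat : Matrix Bool Bool ℂ :=
  Matrix.diagonal fun a => if a = true then Complex.exp (Complex.I * Real.pi / 4) else 1

/-- The one-qubit operator `u` acting on qubit `i` out of `N`. -/
def onQubit {N : ℕ} (i : Fin N) (u : Matrix Bool Bool ℂ) : QMat N := fun x y =>
  if ∀ j, j ≠ i → x j = y j then u (x i) (y i) else 0

/-- `CNOT` on basis states; it does nothing if the two qubits coincide. -/
def cnotBits {N : ℕ} (i j : Fin N) (x : Bits N) : Bits N :=
  if i = j then x else Function.update x j (xor (x i) (x j))

/-- The channel of one gate on the state of `N` qubits. Measuring a qubit leaves the outcome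
in that qubit. A gate whose address is out of range does nothing. -/
def Gate.act {N : ℕ} (g : Gate) (ρ : QMat N) : QMat N :=
  match g with
  | .had i => if h : i < N then onQubit ⟨i, h⟩ hadMat * ρ * (onQubit ⟨i, h⟩ hadMat).conjTranspose
      else ρ
  | .tee i => if h : i < N then onQubit ⟨i, h⟩ teeMat * ρ * (onQubit ⟨i, h⟩ teeMat).conjTranspose
      else ρ
  | .cnot i j => if h : i < N ∧ j < N then
      fun x y => ρ (cnotBits ⟨i, h.1⟩ ⟨j, h.2⟩ x) (cnotBits ⟨i, h.1⟩ ⟨j, h.2⟩ y) else ρ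
  | .meas i => if h : i < N then fun x y => if x ⟨i, h⟩ = y ⟨i, h⟩ then ρ x y else 0 else ρ

/-- A circuit: a list of gates, the first gate being applied first. -/
abbrev Circuit : Type := List Gate

def circuitWidth (C : Circuit) : ℕ := C.foldr (fun g w => max g.width w) 0

/-- The first `a` bits of `x`, filled up with `0` if `x` is shorter. -/
def resize {N : ℕ} (a : ℕ) (x : Bits N) : Bits a :=
  fun i => if h : i.val < N then x ⟨i, h⟩ else false

/-- `ρ ⊗ |0⋯0⟩⟨0⋯0|` on `N ≥ a` qubits. -/
def pad {a : ℕ} (N : ℕ) (ρ : QMat a) : QMat N := fun x y =>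
  if ∀ i : Fin N, a ≤ i.val → x i = false ∧ y i = false then ρ (resize a x) (resize a y) else 0

/-- The partial trace over all but the first `o ≤ N` qubits. -/
def keep {N : ℕ} (o : ℕ) (σ : QMat N) : QMat o := fun x y =>
  ∑ z : Bits N, ∑ w : Bits N,
    if resize o z = x ∧ resize o w = y ∧ ∀ i : Fin N, o ≤ i.val → z i = w i then σ z w else 0

/-- The channel from `a` to `o` qubits computed by a circuit: the input sits on the
qubits `0, …, a - 1`, all other qubits start in `|0⟩`, and the output is read from the
qubits `0, …, o - 1`, all others being discarded. -/
def applyCircuit (C : Circuit) {a : ℕ} (o : ℕ) (ρ : QMat a) : QMat o :=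
  keep o (C.foldl (fun σ g => g.act σ) (pad (max (circuitWidth C) (max a o)) ρ))

/-- The probability that the circuit outputs `1` (on qubit `0`) on input `ρ`. -/
def accept (C : Circuit) {a : ℕ} (ρ : QMat a) : ℝ :=
  (applyCircuit C 1 ρ (fun _ => true) (fun _ => true)).re

/-! ### Uniform polynomial-time generation of circuits -/

/-- Programs working on stacks of bits, named by natural numbers (each program uses finitely
many). `emit g` outputs the gate `g`, where the arguments of `g` name the stacks
whose current heights are the addresses of the qubits. -/
inductive Prog : Type
  | push (x : ℕ) (b : Bool)
  | pop (x : ℕ)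
  | emit (g : Gate)
  | seq (p q : Prog)
  | cond (x : ℕ) (p q : Prog)
  | loop (x : ℕ) (p : Prog)

abbrev Store : Type := ℕ → List Bool

/-- `Run p s r C T`: started in store `s`, the program `p` halts in store `r` after `T` steps
and has output the circuit `C`. `cond x p q` runs `p` if the top of stack `x` is `1`, and
`q` if it is `0` or absent; `loop x p` repeats `p` while stack `x` is nonempty. -/
inductive Run : Prog → Store → Store → Circuit → ℕ → Prop
  | push (s : Store) (x : ℕ) (b : Bool) :
      Run (.push x b) s (Function.update s x (b :: s x)) [] 1
  | pop (s : Store) (x : ℕ) : Run (.pop x) s (Function.update s x (s x).tail) [] 1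
  | emit (s : Store) (g : Gate) : Run (.emit g) s s [g.map fun x => (s x).length] 1
  | seq {p q : Prog} {s r u : Store} {C D : Circuit} {T S : ℕ} :
      Run p s r C T → Run q r u D S → Run (.seq p q) s u (C ++ D) (T + S)
  | condTrue {x : ℕ} {p q : Prog} {s r : Store} {C : Circuit} {T : ℕ} :
      (s x).head? = some true → Run p s r C T → Run (.cond x p q) s r C (T + 1)
  | condFalse {x : ℕ} {p q : Prog} {s r : Store} {C : Circuit} {T : ℕ} :
      (s x).head? ≠ some true → Run q s r C T → Run (.cond x p q) s r C (T + 1)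
  | loopDone {x : ℕ} {p : Prog} {s : Store} : s x = [] → Run (.loop x p) s s [] 1
  | loopStep {x : ℕ} {p : Prog} {s r u : Store} {C D : Circuit} {T S : ℕ} :
      s x ≠ [] → Run p s r C T → Run (.loop x p) r u D S →
        Run (.loop x p) s u (C ++ D) (T + S + 1)

/-- The store that holds the numbers of the list `L`, in unary, on the stacks `0, 1, …`. -/
def initStore (L : List ℕ) : Store := fun x => List.replicate (L.getD x 0) true

/-- A QPT algorithm: one program that, given the unary input `inp i`, writes down the
circuit `C i` in a number of steps polynomial in the input length. -/
def IsQPT {ι : Type} (inp : ι → List ℕ) (C : ι → Circuit) : Prop :=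
  ∃ (P : Prog) (q : Polynomial ℕ), ∀ i, ∃ (r : Store) (T : ℕ),
    Run P (initStore (inp i)) r (C i) T ∧ T ≤ q.eval (inp i).sum

/-! ### The generalized Hilbert-Schmidt ensemble -/

/-- The Haar measure on pure states: the uniform probability measure on the unit sphere. -/
def haarState (ι : Type) [Fintype ι] :
    Measure (Metric.sphere (0 : EuclideanSpace ℂ ι) 1) :=
  ((volume : Measure (EuclideanSpace ℂ ι)).toSphere Set.univ)⁻¹ •
    (volume : Measure (EuclideanSpace ℂ ι)).toSphere

/-- The partial trace of `|ψ⟩⟨ψ|` over the last `m` of `n + m` qubits. -/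
def reduced {n m : ℕ} (ψ : EuclideanSpace ℂ (Bits n × Bits m)) : QMat n := fun x y =>
  ∑ z, ψ (x, z) * conj (ψ (y, z))

/-- The expectation of `f ρ` for `ρ` drawn from the `(n, m)` GHSE. -/
def ghseMean (n m : ℕ) (f : QMat n → ℝ) : ℝ :=
  ∫ ψ, f (reduced (ψ : EuclideanSpace ℂ (Bits n × Bits m))) ∂(haarState (Bits n × Bits m))

/-! ### Keyed families, VPRDMs and EFI pairs

Everything is indexed by the number `n` of qubits; `lam n` is the security parameter and
the length of the keys. All algorithms receive `n` and `lam n` in unary. -/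

/-- `f = negl(lam)`. -/
def Negligible (lam : ℕ → ℕ) (f : ℕ → ℝ) : Prop :=
  ∀ c : ℕ, ∀ᶠ n in Filter.atTop, |f n| < ((lam n : ℝ) ^ c)⁻¹

def PolyBounded (t : ℕ → ℕ) : Prop := ∃ q : Polynomial ℕ, ∀ n, t n ≤ q.eval n

/-- For every `n`, an `n`-qubit operator for each key of length `lam n`. -/
abbrev KeyedFamily (lam : ℕ → ℕ) : Type := (n : ℕ) → Bits (lam n) → QMat n

/-- The mean over a uniformly random key. -/
def keyMean {l : ℕ} (f : Bits l → ℝ) : ℝ := (∑ k, f k) / 2 ^ l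

/-- The mean over a uniformly random key different from `k`. -/
def otherKeyMean {l : ℕ} (k : Bits l) (f : Bits l → ℝ) : ℝ :=
  (∑ j ∈ Finset.univ.erase k, f j) / (2 ^ l - 1)

/-- The circuits `V` verify the family `ρ`: the state of key `k` is accepted with certainty
together with `k`, and with negligible probability together with a random other key. -/
def Verifies {lam : ℕ → ℕ} (V : ℕ → Circuit) (ρ : KeyedFamily lam) : Prop :=
  (∀ n k, accept (V n) (tensor (ρ n k) (ketbra k)) = 1) ∧
  ∃ ε : ℕ → ℝ, Negligible lam ε ∧ ∀ n k,
    otherKeyMean k (fun j => accept (V n) (tensor (ρ n k) (ketbra j))) ≤ ε n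

/-- Verifiable pseudorandom density matrices with mixedness parameter `m n`. -/
structure IsVPRDM (lam m : ℕ → ℕ) (ρ : KeyedFamily lam) : Prop where
  poly_key : PolyBounded lam
  density : ∀ n k, IsDensity (ρ n k)
  preparable : ∃ G : ℕ → Circuit, IsQPT (fun n => [n, lam n]) G ∧
    ∀ n k, applyCircuit (G n) n (ketbra k) = ρ n k
  pseudorandom : ∀ t : ℕ → ℕ, PolyBounded t →
    ∀ A : ℕ → Circuit, IsQPT (fun n => [n, lam n]) A →
      Negligible lam fun n =>
        keyMean (fun k => accept (A n) (copies (t n) (ρ n k))) -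
          ghseMean n (m n) (fun σ => accept (A n) (copies (t n) σ))
  verifiable : ∃ V : ℕ → Circuit, IsQPT (fun n => [n, lam n]) V ∧ Verifies V ρ

/-- `|0⟩⟨0|^{⊗ (n - m)} ⊗ I / 2 ^ m`. -/
def tagMixed (n m : ℕ) : QMat n :=
  Matrix.diagonal fun x => if ∀ i : Fin n, i.val < n - m → x i = false then (2 ^ m : ℂ)⁻¹ else 0

/-- Each state is `U_k (|0⟩⟨0|^{⊗ (n - m)} ⊗ I / 2 ^ m) U_k†` for some unitary `U_k`. -/
def IsRotatedTag {lam : ℕ → ℕ} (m : ℕ → ℕ) (ρ : KeyedFamily lam) : Prop :=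
  ∀ n, m n ≤ n ∧ ∀ k, ∃ U ∈ Matrix.unitaryGroup (Bits n) ℂ,
    ρ n k = U * tagMixed n (m n) * U.conjTranspose

/-- The state seen by somebody who does not know the key. -/
def keyAverage {lam : ℕ → ℕ} (ρ : KeyedFamily lam) (n : ℕ) : QMat n :=
  (2 ^ lam n : ℂ)⁻¹ • ∑ k, ρ n k

/-- EFI pairs; the generator receives the bit `b` on top of `n` and `lam n`. -/
structure IsEFIPair (lam : ℕ → ℕ) (ν : Bool → (n : ℕ) → QMat n) : Prop where
  density : ∀ b n, IsDensity (ν b n)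
  efficient : ∃ G : Bool × ℕ → Circuit,
    IsQPT (fun i => [i.2, lam i.2, i.1.toNat]) G ∧
      ∀ b n, applyCircuit (G (b, n)) n (fun _ _ => 1 : QMat 0) = ν b n
  far : ∃ d : ℕ, ∀ᶠ n in Filter.atTop,
    ((lam n : ℝ) ^ d)⁻¹ ≤ traceDist (ν false n) (ν true n)
  indistinguishable : ∀ A : ℕ → Circuit, IsQPT (fun n => [n, lam n]) A →
    Negligible lam fun n => accept (A n) (ν false n) - accept (A n) (ν true n)

/-- The key averages of two keyed families form an EFI pair, and there is a QPT algorithm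
that, given the bit `b` and a key, verifies the states of the family `ρ b`. -/
structure IsVerifiableEFIPair (lam : ℕ → ℕ) (ρ : Bool → KeyedFamily lam) : Prop where
  efi : IsEFIPair lam fun b => keyAverage (ρ b)
  verifiable : ∃ V : Bool × ℕ → Circuit,
    IsQPT (fun i => [i.2, lam i.2, i.1.toNat]) V ∧ ∀ b, Verifies (fun n => V (b, n)) (ρ b)

end QPT

end

noncomputable section

namespace QPT

open scoped ComplexConjugate ComplexOrder
open MeasureTheory

/-! ### Linearity of the channels -/

/-! Acceptance probabilities are real parts of linear functionals of the state, so a circuit cannot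
tell a random key from the average `ν_b`, and one copy of a GHSE state from its mean `I / 2 ^ n`.
That mean does not depend on the mixedness (`ghseMean_linear`). Pseudorandomness with `t = 1` thus
puts both `ν_0` and `ν_1` negligibly close to the same state for every QPT observer, and the
triangle inequality gives indistinguishability.

Statistically they are far apart: `ν_0` has rank at most `2 ^ (λ + m₀)`, while `ν_1 ≤ 2 ^ (-m₁) I`.
The support projection of `ν_0` accepts `ν_0` with certainty and `ν_1` with probability at most `2 ^
(λ + m₀ - m₁)`, which is eventually at most `1 / 2` because `c < γ` and `m₀` is polylogarithmic
(`one_sub_le_traceDist`, `eventually_add_lt`).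

To generate `ν_b`, a Hadamard gate and a measurement on each of `λ` fresh qubits make a random key,
on which the generator of the family is run (`applyCircuit_coinCircuit_append`). The verifiers are
those of the two families, selected by the bit (`IsQPT.select`). -/

theorem act_of_not_lt {N : ℕ} (g : Gate) (h : ¬ g.width ≤ N) :
    (g.act : QMat N → QMat N) = id := by
  funext ρ
  cases g with
  | had i => exact dif_neg h
  | tee i => exact dif_neg h
  | cnot i j => exact dif_neg fun h' => h (max_le h'.1 h'.2)
  | meas i => exact dif_neg h

theorem isLinearMap_conj {N : ℕ} (A B : QMat N) : IsLinearMap ℂ fun ρ => A * ρ * B :=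
  ⟨fun _ _ => by simp only [mul_add, add_mul],
    fun _ _ => by simp only [Matrix.mul_smul, Matrix.smul_mul]⟩

theorem isLinearMap_act {N : ℕ} (g : Gate) : IsLinearMap ℂ (g.act : QMat N → QMat N) := by
  by_cases hg : g.width ≤ N
  swap
  · rw [act_of_not_lt g hg]
    exact LinearMap.id.isLinear
  cases g with
  | had i =>
    have e : (Gate.act (.had i) : QMat N → QMat N) = fun ρ => onQubit ⟨i, hg⟩ hadMat * ρ *
        (onQubit ⟨i, hg⟩ hadMat).conjTranspose := funext fun ρ => dif_pos hg
    rw [e]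
    exact isLinearMap_conj _ _
  | tee i =>
    have e : (Gate.act (.tee i) : QMat N → QMat N) = fun ρ => onQubit ⟨i, hg⟩ teeMat * ρ *
        (onQubit ⟨i, hg⟩ teeMat).conjTranspose := funext fun ρ => dif_pos hg
    rw [e]
    exact isLinearMap_conj _ _
  | cnot i j =>
    have h : i < N ∧ j < N := max_le_iff.mp hg
    have e : (Gate.act (.cnot i j) : QMat N → QMat N) = fun ρ x y =>
        ρ (cnotBits ⟨i, h.1⟩ ⟨j, h.2⟩ x) (cnotBits ⟨i, h.1⟩ ⟨j, h.2⟩ y) :=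
      funext fun ρ => dif_pos h
    rw [e]
    exact ⟨fun _ _ => rfl, fun _ _ => rfl⟩
  | meas i =>
    have e : (Gate.act (.meas i) : QMat N → QMat N) = fun ρ => Matrix.of fun x y =>
        if x ⟨i, hg⟩ = y ⟨i, hg⟩ then ρ x y else 0 := funext fun ρ => dif_pos hg
    rw [e]
    constructor
    · intro ρ σ
      ext x y
      by_cases hx : x ⟨i, hg⟩ = y ⟨i, hg⟩ <;> simp [hx, Matrix.add_apply]
    · intro c ρ
      ext x y
      by_cases hx : x ⟨i, hg⟩ = y ⟨i, hg⟩ <;> simp [hx, Matrix.smul_apply]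

theorem isLinearMap_pad {a : ℕ} (N : ℕ) : IsLinearMap ℂ (pad N : QMat a → QMat N) := by
  constructor
  · intro ρ σ
    ext x y
    simp only [pad, Matrix.add_apply]
    split_ifs <;> simp
  · intro c ρ
    ext x y
    simp only [pad, Matrix.smul_apply]
    split_ifs <;> simp

theorem isLinearMap_keep {N : ℕ} (o : ℕ) : IsLinearMap ℂ (keep o : QMat N → QMat o) := by
  constructor
  · intro ρ σ
    ext x y
    simp only [keep, Matrix.add_apply, ← Finset.sum_add_distrib]
    refine Finset.sum_congr rfl fun z _ => Finset.sum_congr rfl fun w _ => ?_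
    split_ifs <;> simp
  · intro c ρ
    ext x y
    simp only [keep, Matrix.smul_apply, Finset.smul_sum]
    refine Finset.sum_congr rfl fun z _ => Finset.sum_congr rfl fun w _ => ?_
    split_ifs <;> simp

theorem isLinearMap_foldl_act {N : ℕ} (C : Circuit) :
    IsLinearMap ℂ fun ρ : QMat N => C.foldl (fun σ g => g.act σ) ρ := by
  induction C with
  | nil => exact ⟨fun _ _ => rfl, fun _ _ => rfl⟩
  | cons g C ih =>
    constructor
    · intro ρ σ
      simp only [List.foldl_cons, (isLinearMap_act g).map_add]
      exact ih.map_add _ _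
    · intro c ρ
      simp only [List.foldl_cons, (isLinearMap_act g).map_smul]
      exact ih.map_smul _ _

/-- The channel of a circuit, run on `N` qubits. -/
def channel (C : Circuit) (a N o : ℕ) : QMat a →ₗ[ℂ] QMat o :=
  (isLinearMap_keep o).mk' _ ∘ₗ (isLinearMap_foldl_act (N := N) C).mk' _ ∘ₗ
    (isLinearMap_pad N).mk' _

theorem applyCircuit_eq_channel (C : Circuit) {a : ℕ} (o : ℕ) (ρ : QMat a) :
    applyCircuit C o ρ = channel C a (max (circuitWidth C) (max a o)) o ρ := rfl

/-- The amplitude whose real part is the acceptance probability. -/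
def acceptLin (C : Circuit) (a : ℕ) : QMat a →ₗ[ℂ] ℂ :=
  Matrix.entryLinearMap ℂ ℂ (fun _ => true) (fun _ => true) ∘ₗ
    channel C a (max (circuitWidth C) (max a 1)) 1

theorem accept_eq_re (C : Circuit) {a : ℕ} (ρ : QMat a) :
    accept C ρ = (acceptLin C a ρ).re := rfl

/-- By linearity the key average can be taken outside the circuit. This ties the one-copy experiment
of `IsVPRDM` to the state `ν_b`. -/
theorem accept_keyAverage {lam : ℕ → ℕ} (C : Circuit) (ρ : KeyedFamily lam) (n : ℕ) :
    accept C (keyAverage ρ n) = keyMean fun k => accept C (ρ n k) := by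
  simp only [accept_eq_re, keyAverage, map_smul, map_sum, keyMean, smul_eq_mul]
  rw [div_eq_inv_mul, ← Complex.re_sum, ← Complex.re_ofReal_mul]
  push_cast
  rfl

theorem accept_copies_one (C : Circuit) {n : ℕ} (ρ : QMat n) :
    accept C (copies 1 ρ) = accept C ρ := by
  -- `copies 1 ρ` has type `QMat (1 * n)`, so the number of qubits is generalized until the equation
  -- can be substituted.
  have key : ∀ (m : ℕ) (h : m = n) (σ : QMat m),
      (∀ x y, σ x y = ρ (fun i => x (i.cast h.symm)) (fun i => y (i.cast h.symm))) →
      accept C σ = accept C ρ := by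
    rintro m rfl σ hσ
    exact congrArg _ (Matrix.ext hσ)
  refine key (1 * n) (one_mul n) _ fun x y => ?_
  simp only [copies, Finset.univ_unique, Fin.default_eq_zero, Finset.prod_singleton]
  congr 1

/-! ### Preparation of a uniformly random key -/

theorem circuitWidth_append (C D : Circuit) :
    circuitWidth (C ++ D) = max (circuitWidth C) (circuitWidth D) := by
  induction C with
  | nil => simp [circuitWidth]
  | cons g C ih =>
    simp only [circuitWidth, List.cons_append, List.foldr_cons] at ih ⊢
    rw [ih, max_assoc]

/-- Hadamard gates and measurements on the qubits `l - 1, …, 0`. -/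
def coinCircuit : ℕ → Circuit
  | 0 => []
  | l + 1 => [.had l, .meas l] ++ coinCircuit l

theorem circuitWidth_coinCircuit (l : ℕ) : circuitWidth (coinCircuit l) = l := by
  induction l with
  | zero => rfl
  | succ l ih =>
    rw [coinCircuit, circuitWidth_append, ih]
    simp [circuitWidth, Gate.width]

/-- In row `x` of `onQubit i u` only the columns that agree with `x` off `i` survive, one for each
value of qubit `i`. -/
theorem onQubit_mul {N : ℕ} (i : Fin N) (u : Matrix Bool Bool ℂ) (ρ : QMat N) (x y : Bits N) :
    (onQubit i u * ρ) x y = ∑ b, u (x i) b * ρ (Function.update x i b) y := by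
  rw [Matrix.mul_apply]
  symm
  refine Finset.sum_of_injOn (fun b => Function.update x i b) ?_ (by simp) ?_ ?_
  · intro b _ b' _ h
    simpa using congrFun h i
  · intro z _ hz
    have : ¬ ∀ j, j ≠ i → x j = z j := by
      intro h
      refine hz ⟨z i, by simp, ?_⟩
      ext j
      by_cases hj : j = i
      · subst hj; simp
      · simp [hj, h j hj]
    simp [onQubit, this]
  · intro b _
    have : ∀ j, j ≠ i → x j = Function.update x i b j := fun j hj => by simp [hj]
    simp only [onQubit]
    rw [if_pos this, Function.update_self]

theorem mul_onQubit_conjTranspose {N : ℕ} (i : Fin N) (u : Matrix Bool Bool ℂ) (ρ : QMat N)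
    (x y : Bits N) :
    (ρ * (onQubit i u).conjTranspose) x y =
      ∑ b, ρ x (Function.update y i b) * conj (u (y i) b) := by
  have h := onQubit_mul i u ρ.conjTranspose y x
  have h2 : (ρ * (onQubit i u).conjTranspose) x y =
      conj ((onQubit i u * ρ.conjTranspose) y x) := by
    rw [← Matrix.conjTranspose_conjTranspose (ρ * _), Matrix.conjTranspose_mul,
      Matrix.conjTranspose_conjTranspose]
    rfl
  rw [h2, h, map_sum]
  refine Finset.sum_congr rfl fun b _ => ?_
  simp [mul_comm]

/-- The state in which the qubits in `[a, b)` are uniformly random bits, the others `0`. -/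
def coinState (N a b : ℕ) : QMat N := fun x y =>
  if x = y ∧ ∀ i : Fin N, (i.val < a ∨ b ≤ i.val) → x i = false then ((2 : ℂ) ^ (b - a))⁻¹ else 0

/-- The Hadamard gate turns `|0⟩` into a state all of whose entries are `1 / 2`; measuring erases
the two off-diagonal ones and leaves a fair bit. -/
theorem act_had_meas_coinState {N l b : ℕ} (hl : l < b) (hb : b ≤ N) :
    Gate.act (.meas l) (Gate.act (.had l) (coinState N (l + 1) b)) = coinState N l b := by
  have hN : l < N := by omega
  set i : Fin N := ⟨l, hN⟩ with hi
  have hsq : ((Real.sqrt 2 : ℝ) : ℂ)⁻¹ * ((Real.sqrt 2 : ℝ) : ℂ)⁻¹ = 2⁻¹ := by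
    rw [← mul_inv, ← Complex.ofReal_mul, Real.mul_self_sqrt (by norm_num)]
    norm_num
  have hpow : ((2 : ℂ) ^ (b - l))⁻¹ = 2⁻¹ * ((2 : ℂ) ^ (b - (l + 1)))⁻¹ := by
    rw [← mul_inv, ← pow_succ']
    congr 2
    omega
  have e : Gate.act (.meas l) (Gate.act (.had l) (coinState N (l + 1) b)) =
      Matrix.of fun x y => if x i = y i then (onQubit i hadMat * coinState N (l + 1) b *
        (onQubit i hadMat).conjTranspose) x y else 0 := by
    have e1 : Gate.act (.had l) (coinState N (l + 1) b) = onQubit i hadMat *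
      coinState N (l + 1) b * (onQubit i hadMat).conjTranspose := dif_pos hN
    rw [e1]
    exact dif_pos hN
  ext x y
  rw [e, Matrix.of_apply]
  -- Qubit `l` is still `0` before the gate, so of the four terms of the double sum only `b₁ = b₂ =
  -- false` remains.
  have key : ∀ b₁ b₂ : Bool, coinState N (l + 1) b (Function.update x i b₁)
      (Function.update y i b₂) = if b₁ = false ∧ b₂ = false ∧ (∀ j, j ≠ i → x j = y j) ∧
        (∀ j : Fin N, (j.val < l ∨ b ≤ j.val) → x j = false)
        then ((2 : ℂ) ^ (b - (l + 1)))⁻¹ else 0 := by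
    intro b₁ b₂
    refine if_congr ⟨fun ⟨h1, h2⟩ => ?_, fun ⟨h1, h2, h3, h4⟩ => ⟨?_, ?_⟩⟩ rfl rfl
    · have e1 : b₁ = b₂ := by simpa using congrFun h1 i
      have e2 : b₁ = false := by simpa using h2 i (Or.inl (Nat.lt_succ_self l))
      refine ⟨e2, e1 ▸ e2, fun j hj => by simpa [hj] using congrFun h1 j, fun j hj => ?_⟩
      have hji : j ≠ i := by
        rintro rfl
        simp only [hi] at hj
        omega
      simpa [hji] using h2 j (by omega)
    · subst h1 h2
      ext j
      by_cases hj : j = i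
      · subst hj; simp
      · simpa [hj] using h3 j hj
    · intro j hj
      by_cases hji : j = i
      · subst hji; simpa using h1
      · have : j.val ≠ l := fun h => hji (Fin.ext h)
        simpa [hji] using h4 j (by omega)
  simp only [mul_onQubit_conjTranspose, onQubit_mul, key]
  have hR : (∀ j, j ≠ i → x j = y j) ∧ x i = y i ↔ x = y :=
    ⟨fun h => funext fun j => by
      by_cases hj : j = i
      · exact hj ▸ h.2
      · exact h.1 j hj, fun h => by simp [h]⟩
  have hS : coinState N l b x y = if ((∀ j, j ≠ i → x j = y j) ∧ x i = y i) ∧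
      ∀ j : Fin N, (j.val < l ∨ b ≤ j.val) → x j = false
      then 2⁻¹ * ((2 : ℂ) ^ (b - (l + 1)))⁻¹ else 0 := by
    simp only [coinState, hR, hpow]
  rw [hS]
  by_cases h1 : x i = y i
  · by_cases h2 : ∀ j, j ≠ i → x j = y j
    · by_cases h3 : ∀ j : Fin N, (j.val < l ∨ b ≤ j.val) → x j = false
      · rw [if_pos h1, if_pos ⟨⟨h2, h1⟩, h3⟩]
        have hF : ∀ a, hadMat a false = ((Real.sqrt 2 : ℝ) : ℂ)⁻¹ := fun a => by simp [hadMat]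
        simp only [Fintype.sum_bool, Bool.true_eq_false, false_and, if_false, mul_zero,
          zero_mul, zero_add, true_and]
        rw [if_pos ⟨h2, h3⟩, hF, hF, map_inv₀, Complex.conj_ofReal, ← hsq]
        ring
      · simp [h3]
    · simp [h2]
  · simp [h1]

theorem foldl_coinCircuit {N b l : ℕ} (hl : l ≤ b) (hb : b ≤ N) :
    (coinCircuit l).foldl (fun σ g => g.act σ) (coinState N l b) = coinState N 0 b := by
  induction l with
  | zero => rfl
  | succ l ih =>
    simp only [coinCircuit, List.cons_append, List.nil_append, List.foldl_cons]
    rw [act_had_meas_coinState hl hb]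
    exact ih (by omega)

theorem pad_one (N b : ℕ) : pad N (fun _ _ => 1 : QMat 0) = coinState N b b := by
  ext x y
  simp only [pad, coinState, Nat.sub_self, pow_zero, inv_one]
  refine if_congr ⟨fun h => ⟨funext fun i => ?_, fun i _ => (h i (Nat.zero_le _)).1⟩,
    fun h i _ => ?_⟩ rfl rfl
  · rw [(h i (Nat.zero_le _)).1, (h i (Nat.zero_le _)).2]
  -- The interval `[b, b)` is empty: every qubit lies outside it.
  · have := h.2 i (lt_or_ge _ _)
    exact ⟨this, h.1 ▸ this⟩

/-- Written as a padded mixture of keys, the coin state is an input to which linearity of the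
channel applies. -/
theorem coinState_eq_sum (N l : ℕ) :
    coinState N 0 l = pad N ((2 ^ l : ℂ)⁻¹ • ∑ k : Bits l, ketbra k) := by
  ext x y
  have hsum : (∑ k : Bits l, ketbra k) (resize l x) (resize l y) =
      if resize l x = resize l y then 1 else 0 := by
    rw [Matrix.sum_apply]
    simp only [ketbra]
    rw [Finset.sum_eq_single (resize l x) (fun k _ hk => by simp [hk.symm]) (by simp)]
    simp [eq_comm]
  simp only [coinState, pad, Matrix.smul_apply, hsum, smul_eq_mul, mul_ite, mul_one, mul_zero,
    Nat.sub_zero, ← ite_and]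
  refine if_congr ⟨fun ⟨h1, h2⟩ => ?_, fun ⟨h1, h2⟩ => ⟨funext fun i => ?_, fun i hi => ?_⟩⟩ rfl rfl
  · subst h1
    exact ⟨fun i hi => ⟨h2 i (Or.inr hi), h2 i (Or.inr hi)⟩, rfl⟩
  · by_cases hi : l ≤ i.val
    · rw [(h1 i hi).1, (h1 i hi).2]
    · have := congrFun h2 ⟨i.val, by omega⟩
      simpa [resize] using this
  · exact (h1 i (by omega)).1

theorem applyCircuit_coinCircuit_append (C : Circuit) (l o : ℕ) :
    applyCircuit (coinCircuit l ++ C) o (fun _ _ => 1 : QMat 0) =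
      (2 ^ l : ℂ)⁻¹ • ∑ k : Bits l, applyCircuit C o (ketbra k) := by
  -- Both runs use the same number of qubits: the width `l` of the coin circuit equals the number of
  -- key qubits that `C` takes as input.
  have hN : max (circuitWidth (coinCircuit l ++ C)) (max 0 o) =
      max (circuitWidth C) (max l o) := by
    rw [circuitWidth_append, circuitWidth_coinCircuit]
    omega
  have hl : l ≤ max (circuitWidth C) (max l o) := by omega
  have key : ∀ u : QMat 0, (∀ N, pad N u = coinState N l l) →
      applyCircuit (coinCircuit l ++ C) o u =
        (2 ^ l : ℂ)⁻¹ • ∑ k : Bits l, applyCircuit C o (ketbra k) := by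
    intro u hu
    simp only [applyCircuit_eq_channel]
    rw [hN, ← map_sum, ← map_smul]
    change keep o ((coinCircuit l ++ C).foldl _ (pad _ u)) = keep o (C.foldl _ (pad _ _))
    rw [List.foldl_append, hu, foldl_coinCircuit le_rfl hl, coinState_eq_sum]
  exact key _ fun N => pad_one N l

/-! ### Programs -/

/-- Runs `p` on the input without its last number, a bit, if that bit is `1`, else `q`. -/
def selectProg (p q : Prog) : Prog := .cond 2 (.seq (.pop 2) p) q

/-- Stacks beyond the input list are empty, so the bit `0` leaves no trace and popping the bit `1`
restores the two-number input. -/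
theorem initStore_bit (a b : ℕ) (x : Bool) :
    initStore [a, b, x.toNat] = Function.update (initStore [a, b]) 2 (List.replicate x.toNat true) := by
  funext i
  rcases eq_or_ne i 2 with rfl | hi
  · simp [initStore]
  · rw [Function.update_of_ne hi]
    match i, hi with
    | 0, _ => rfl
    | 1, _ => rfl
    | i + 3, _ => simp [initStore]

theorem initStore_false (a b : ℕ) : initStore [a, b, false.toNat] = initStore [a, b] := by
  rw [initStore_bit]
  exact Function.update_eq_self 2 (initStore [a, b])

theorem initStore_true (a b : ℕ) : Function.update (initStore [a, b, true.toNat]) 2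
    (initStore [a, b, true.toNat] 2).tail = initStore [a, b] := by
  rw [initStore_bit, Function.update_idem, Function.update_self]
  exact Function.update_eq_self 2 (initStore [a, b])

theorem run_selectProg_true {p q : Prog} {a b : ℕ} {r : Store} {C : Circuit} {T : ℕ}
    (h : Run p (initStore [a, b]) r C T) :
    Run (selectProg p q) (initStore [a, b, true.toNat]) r C (1 + T + 1) := by
  refine Run.condTrue rfl ?_
  have h1 := Run.pop (initStore [a, b, true.toNat]) 2
  rw [initStore_true] at h1
  exact Run.seq h1 h

theorem run_selectProg_false {p q : Prog} {a b : ℕ} {r : Store} {C : Circuit} {T : ℕ}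
    (h : Run q (initStore [a, b]) r C T) :
    Run (selectProg p q) (initStore [a, b, false.toNat]) r C (T + 1) := by
  rw [initStore_false]
  exact Run.condFalse (by simp [initStore]) h

/-- Choosing between two QPT algorithms by an additional input bit. -/
theorem IsQPT.select {lam : ℕ → ℕ} {C : Bool → ℕ → Circuit}
    (h : ∀ b, IsQPT (fun n => [n, lam n]) (C b)) :
    IsQPT (fun i : Bool × ℕ => [i.2, lam i.2, i.1.toNat]) fun i => C i.1 i.2 := by
  obtain ⟨P₀, q₀, h₀⟩ := h false
  obtain ⟨P₁, q₁, h₁⟩ := h true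
  -- The `2` pays for the branch and for popping the bit.
  refine ⟨selectProg P₁ P₀, q₀ + q₁ + 2, ?_⟩
  have mono : ∀ (q : Polynomial ℕ) {x y : ℕ}, x ≤ y → q.eval x ≤ q.eval y := by
    intro q x y hxy
    rw [Polynomial.eval_eq_sum, Polynomial.eval_eq_sum]
    exact Finset.sum_le_sum fun i _ => Nat.mul_le_mul_left _ (Nat.pow_le_pow_left hxy i)
  rintro ⟨b, n⟩
  have hs : [n, lam n].sum ≤ [n, lam n, b.toNat].sum := by
    simp only [List.sum_cons, List.sum_nil]
    omega
  cases b with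
  | false =>
    obtain ⟨r, T, hr, hT⟩ := h₀ n
    refine ⟨r, _, run_selectProg_false hr, ?_⟩
    have := hT.trans (mono q₀ hs)
    simp only [Polynomial.eval_add, Polynomial.eval_ofNat]
    omega
  | true =>
    obtain ⟨r, T, hr, hT⟩ := h₁ n
    refine ⟨r, _, run_selectProg_true hr, ?_⟩
    have := hT.trans (mono q₁ hs)
    simp only [Polynomial.eval_add, Polynomial.eval_ofNat]
    omega

/-- Writes down the coin flips on the qubits below the height of stack `1`. -/
def coinProg : Prog :=
  .seq
    -- Popping before emitting makes the addresses `l - 1, …, 0`, the order in `coinCircuit`.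
    (.loop 1 (.seq (.pop 1) (.seq (.push 3 true) (.seq (.emit (.had 1)) (.emit (.meas 1))))))
    -- Stack `3` has counted the rounds; stack `1` is rebuilt from it for the program that runs
    -- next.
    (.loop 3 (.seq (.pop 3) (.push 1 true)))

/-- The store with stacks `1` and `3` holding the given unary numbers. -/
def coinStore (s : Store) (a b : ℕ) : Store :=
  Function.update (Function.update s 1 (List.replicate a true)) 3 (List.replicate b true)

theorem coinStore_one (s : Store) (a b : ℕ) : coinStore s a b 1 = List.replicate a true := by
  simp [coinStore]

theorem coinStore_three (s : Store) (a b : ℕ) : coinStore s a b 3 = List.replicate b true := by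
  simp [coinStore]

theorem update_coinStore_one (s : Store) (a b c : ℕ) :
    Function.update (coinStore s a b) 1 (List.replicate c true) = coinStore s c b := by
  rw [coinStore, Function.update_comm (by decide), Function.update_idem]
  rfl

theorem update_coinStore_three (s : Store) (a b c : ℕ) :
    Function.update (coinStore s a b) 3 (List.replicate c true) = coinStore s a c :=
  Function.update_idem _ _ _

theorem run_pop_one (s : Store) (a b : ℕ) :
    Run (.pop 1) (coinStore s (a + 1) b) (coinStore s a b) [] 1 := by
  have h := Run.pop (coinStore s (a + 1) b) 1
  rwa [coinStore_one, List.replicate_succ, List.tail_cons, update_coinStore_one] at h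

theorem run_pop_three (s : Store) (a b : ℕ) :
    Run (.pop 3) (coinStore s a (b + 1)) (coinStore s a b) [] 1 := by
  have h := Run.pop (coinStore s a (b + 1)) 3
  rwa [coinStore_three, List.replicate_succ, List.tail_cons, update_coinStore_three] at h

theorem run_push_one (s : Store) (a b : ℕ) :
    Run (.push 1 true) (coinStore s a b) (coinStore s (a + 1) b) [] 1 := by
  have h := Run.push (coinStore s a b) 1 true
  rwa [coinStore_one, ← List.replicate_succ, update_coinStore_one] at h

theorem run_push_three (s : Store) (a b : ℕ) :
    Run (.push 3 true) (coinStore s a b) (coinStore s a (b + 1)) [] 1 := by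
  have h := Run.push (coinStore s a b) 3 true
  rwa [coinStore_three, ← List.replicate_succ, update_coinStore_three] at h

/-- A round costs five steps (pop, push, two gates, loop test), and leaving the loop costs one. -/
theorem run_coin_loop (s : Store) (a b : ℕ) :
    Run (.loop 1 (.seq (.pop 1) (.seq (.push 3 true) (.seq (.emit (.had 1)) (.emit (.meas 1))))))
      (coinStore s a b) (coinStore s 0 (b + a)) (coinCircuit a) (5 * a + 1) := by
  induction a generalizing b with
  | zero => exact Run.loopDone (coinStore_one s 0 b)
  | succ a ih =>
    have hh := Run.emit (coinStore s a (b + 1)) (.had 1)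
    have hm := Run.emit (coinStore s a (b + 1)) (.meas 1)
    have hb := Run.seq (run_pop_one s a b) (Run.seq (run_push_three s a b) (Run.seq hh hm))
    have h := Run.loopStep (x := 1) (by simp [coinStore_one]) hb (ih (b + 1))
    simp only [Gate.map, coinStore_one, List.length_replicate, List.nil_append] at h
    rw [show b + (a + 1) = b + 1 + a by omega, show 5 * (a + 1) + 1 =
      1 + (1 + (1 + 1)) + (5 * a + 1) + 1 by omega]
    exact h

theorem run_restore_loop (s : Store) (a b : ℕ) :
    Run (.loop 3 (.seq (.pop 3) (.push 1 true)))
      (coinStore s a b) (coinStore s (a + b) 0) [] (3 * b + 1) := by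
  induction b generalizing a with
  | zero => exact Run.loopDone (coinStore_three s a 0)
  | succ b ih =>
    have hb := Run.seq (run_pop_three s a b) (run_push_one s a b)
    have h := Run.loopStep (x := 3) (by simp [coinStore_three]) hb (ih (a + 1))
    rw [show a + (b + 1) = a + 1 + b by omega, show 3 * (b + 1) + 1 =
      1 + 1 + (3 * b + 1) + 1 by omega]
    exact h

theorem run_coinProg (n l : ℕ) :
    Run coinProg (initStore [n, l]) (initStore [n, l]) (coinCircuit l) (8 * l + 2) := by
  have hs : initStore [n, l] = coinStore (initStore [n, l]) l 0 := by
    rw [coinStore]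
    have h1 : Function.update (initStore [n, l]) 1 (List.replicate l true) = initStore [n, l] :=
      Function.update_eq_self 1 (initStore [n, l])
    rw [h1]
    exact (Function.update_eq_self 3 (initStore [n, l])).symm
  have h := Run.seq (run_coin_loop (initStore [n, l]) l 0)
    (run_restore_loop (initStore [n, l]) 0 (0 + l))
  rw [List.append_nil, zero_add, zero_add, ← hs,
    show 5 * l + 1 + (3 * l + 1) = 8 * l + 2 by omega] at h
  exact h

/-- Running a QPT algorithm on a uniformly random key. -/
theorem IsQPT.coinCircuit_append {lam : ℕ → ℕ} {C : ℕ → Circuit}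
    (h : IsQPT (fun n => [n, lam n]) C) :
    IsQPT (fun n => [n, lam n]) fun n => coinCircuit (lam n) ++ C n := by
  obtain ⟨P, q, h⟩ := h
  refine ⟨.seq coinProg P, 8 * Polynomial.X + 2 + q, fun n => ?_⟩
  obtain ⟨r, T, hr, hT⟩ := h n
  refine ⟨r, _, Run.seq (run_coinProg n (lam n)) hr, ?_⟩
  simp only [Polynomial.eval_add, Polynomial.eval_mul, Polynomial.eval_ofNat, Polynomial.eval_X]
  simp only [List.sum_cons, List.sum_nil] at hT ⊢
  omega

/-! ### The mean of the Hilbert-Schmidt ensemble -/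

/-- A linear isometry, restricted to the unit sphere. -/
def sphereHomeomorph {V : Type*} [NormedAddCommGroup V] [NormedSpace ℝ V] (φ : V ≃ₗᵢ[ℝ] V) :
    Metric.sphere (0 : V) 1 ≃ₜ Metric.sphere (0 : V) 1 :=
  φ.toHomeomorph.subtype fun x => by simp

theorem coe_sphereHomeomorph {V : Type*} [NormedAddCommGroup V] [NormedSpace ℝ V]
    (φ : V ≃ₗᵢ[ℝ] V) (x : Metric.sphere (0 : V) 1) :
    (sphereHomeomorph φ x : V) = φ x := rfl

/-- The spherical measure of `s` is, up to a constant, the volume of the cone `(0, 1) • s`. A linear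
isometry maps cones to cones and preserves volume. -/
theorem measurePreserving_sphereHomeomorph {V : Type*} [NormedAddCommGroup V]
    [InnerProductSpace ℝ V] [FiniteDimensional ℝ V] [MeasurableSpace V] [BorelSpace V]
    (φ : V ≃ₗᵢ[ℝ] V) :
    MeasurePreserving (sphereHomeomorph φ) (volume : Measure V).toSphere
      (volume : Measure V).toSphere := by
  refine ⟨(sphereHomeomorph φ).continuous.measurable, ?_⟩
  ext s hs
  have hs' := (sphereHomeomorph φ).continuous.measurable hs
  rw [Measure.map_apply (sphereHomeomorph φ).continuous.measurable hs,
    Measure.toSphere_apply' _ hs', Measure.toSphere_apply' _ hs]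
  congr 1
  conv_rhs => rw [← φ.measurePreserving.measure_preimage_emb φ.toHomeomorph.measurableEmbedding]
  congr 1
  ext v
  simp only [Set.mem_smul, Set.mem_preimage, Set.mem_image]
  constructor
  · rintro ⟨r, hr, _, ⟨x, hx, rfl⟩, rfl⟩
    exact ⟨r, hr, _, ⟨_, hx, rfl⟩, by rw [coe_sphereHomeomorph, map_smul]⟩
  · rintro ⟨r, hr, _, ⟨x, hx, rfl⟩, h⟩
    refine ⟨r, hr, _, ⟨(sphereHomeomorph φ).symm x, by simpa using hx, rfl⟩, ?_⟩
    apply φ.injective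
    rw [map_smul, ← h, ← coe_sphereHomeomorph, Homeomorph.apply_symm_apply]

theorem integral_haarState_comp {ι : Type} [Fintype ι]
    (φ : EuclideanSpace ℂ ι ≃ₗᵢ[ℝ] EuclideanSpace ℂ ι) (F : EuclideanSpace ℂ ι → ℂ) :
    ∫ ψ, F (φ ψ) ∂(haarState ι) = ∫ ψ, F ψ ∂(haarState ι) := by
  have h := (measurePreserving_sphereHomeomorph φ).integral_comp
    (sphereHomeomorph φ).measurableEmbedding (fun ψ => F ψ)
  unfold haarState
  rw [integral_smul_measure, integral_smul_measure]
  exact congrArg _ h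

instance isProbabilityMeasure_haarState {ι : Type} [Fintype ι] [Nonempty ι] :
    IsProbabilityMeasure (haarState ι) := by
  refine ⟨?_⟩
  have h : (volume : Measure (EuclideanSpace ℂ ι)).toSphere Set.univ ≠ 0 := by
    rw [Ne, Measure.measure_univ_eq_zero]
    exact Measure.toSphere_ne_zero _
  rw [haarState, Measure.smul_apply, smul_eq_mul]
  exact ENNReal.inv_mul_cancel h (measure_ne_top _ _)

theorem integrable_haarState {ι : Type} [Fintype ι] [Nonempty ι] {G : Type*}
    [NormedAddCommGroup G] {F : EuclideanSpace ℂ ι → G} (hF : Continuous F) :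
    Integrable (fun ψ : Metric.sphere (0 : EuclideanSpace ℂ ι) 1 => F ψ) (haarState ι) := by
  have hc : Continuous fun ψ : Metric.sphere (0 : EuclideanSpace ℂ ι) 1 => F ψ :=
    hF.comp continuous_subtype_val
  exact hc.integrable_of_hasCompactSupport (HasCompactSupport.of_compactSpace _)

theorem continuous_reduced_apply {n m : ℕ} (x y : Bits n) :
    Continuous fun ψ : EuclideanSpace ℂ (Bits n × Bits m) => reduced ψ x y := by
  unfold reduced
  fun_prop

/-- Negating all amplitudes whose first index is `x` preserves the Haar measure and changes the sign
of the entry, as `y ≠ x`. -/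
theorem integral_reduced_of_ne {n m : ℕ} {x y : Bits n} (h : x ≠ y) :
    ∫ ψ, reduced (ψ : EuclideanSpace ℂ (Bits n × Bits m)) x y
      ∂(haarState (Bits n × Bits m)) = 0 := by
  have key := integral_haarState_comp (ι := Bits n × Bits m)
    (LinearIsometryEquiv.piLpCongrRight 2 fun p =>
      if p.1 = x then LinearIsometryEquiv.neg ℝ else LinearIsometryEquiv.refl ℝ ℂ)
    (fun ψ => reduced ψ x y)
  have : ∀ ψ : EuclideanSpace ℂ (Bits n × Bits m),
      reduced (LinearIsometryEquiv.piLpCongrRight 2 (fun p : Bits n × Bits m =>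
        if p.1 = x then LinearIsometryEquiv.neg ℝ else LinearIsometryEquiv.refl ℝ ℂ) ψ) x y =
      - reduced ψ x y := by
    intro ψ
    simp [reduced, h.symm]
  simp only [this, integral_neg] at key
  exact self_eq_neg.mp key.symm

/-- Swapping `x` and `y` in the first register preserves the Haar measure. -/
theorem integral_reduced_self {n m : ℕ} (x y : Bits n) :
    ∫ ψ, reduced (ψ : EuclideanSpace ℂ (Bits n × Bits m)) x x ∂(haarState (Bits n × Bits m)) =
      ∫ ψ, reduced (ψ : EuclideanSpace ℂ (Bits n × Bits m)) y y
        ∂(haarState (Bits n × Bits m)) := by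
  have key := integral_haarState_comp (ι := Bits n × Bits m)
    (LinearIsometryEquiv.piLpCongrLeft 2 ℝ ℂ
      ((Equiv.swap x y).prodCongr (Equiv.refl (Bits m))))
    (fun ψ => reduced ψ y y)
  rw [← key]
  congr 1
  ext ψ
  simp [reduced]

theorem trace_reduced {n m : ℕ} (ψ : EuclideanSpace ℂ (Bits n × Bits m)) (h : ‖ψ‖ = 1) :
    ∑ x, reduced ψ x x = 1 := by
  have h2 := EuclideanSpace.norm_sq_eq ψ
  rw [h, one_pow] at h2
  simp only [reduced, Complex.mul_conj, Complex.normSq_eq_norm_sq]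
  rw [← Fintype.sum_prod_type']
  exact_mod_cast h2.symm

/-- Sign flips kill the off-diagonal entries; the `2 ^ n` diagonal ones are equal by permutation
symmetry and add up to the trace `1`. -/
theorem integral_reduced {n m : ℕ} (x y : Bits n) :
    ∫ ψ, reduced (ψ : EuclideanSpace ℂ (Bits n × Bits m)) x y ∂(haarState (Bits n × Bits m)) =
      ((2 ^ n : ℂ)⁻¹ • (1 : QMat n)) x y := by
  rcases eq_or_ne x y with rfl | h
  · have h1 : ∑ y : Bits n, ∫ ψ, reduced (ψ : EuclideanSpace ℂ (Bits n × Bits m)) y y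
        ∂(haarState (Bits n × Bits m)) = 1 := by
      rw [← integral_finsetSum _ fun y _ => integrable_haarState (continuous_reduced_apply y y)]
      rw [integral_congr_ae (g := fun _ => 1)
        (Filter.Eventually.of_forall fun ψ => trace_reduced _ (by simp))]
      simp
    rw [Finset.sum_congr rfl fun y _ => integral_reduced_self y x] at h1
    simp only [Finset.sum_const, Finset.card_univ, Fintype.card_pi, Fintype.card_bool,
      Finset.prod_const, Fintype.card_fin, nsmul_eq_mul, Nat.cast_pow, Nat.cast_ofNat] at h1
    simpa using eq_inv_of_mul_eq_one_right h1
  · simp [integral_reduced_of_ne h, h]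

theorem ghseMean_linear (n m : ℕ) (f : QMat n →ₗ[ℂ] ℂ) :
    ghseMean n m (fun σ => (f σ).re) = (f ((2 ^ n : ℂ)⁻¹ • 1)).re := by
  have hf : ∀ σ : QMat n, f σ = ∑ x, ∑ y, σ x y * f (Matrix.single x y 1) := by
    intro σ
    conv_lhs => rw [Matrix.matrix_eq_sum_single σ]
    simp only [map_sum]
    refine Finset.sum_congr rfl fun x _ => Finset.sum_congr rfl fun y _ => ?_
    rw [← smul_eq_mul, ← map_smul, Matrix.smul_single, smul_eq_mul, mul_one]
  have hi : ∀ x y, Integrable (fun ψ : Metric.sphere (0 : EuclideanSpace ℂ (Bits n × Bits m)) 1 =>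
      reduced (ψ : EuclideanSpace ℂ (Bits n × Bits m)) x y * f (Matrix.single x y 1))
      (haarState (Bits n × Bits m)) := fun x y =>
    (integrable_haarState (continuous_reduced_apply x y)).mul_const _
  have hs : ∀ x, Integrable (fun ψ : Metric.sphere (0 : EuclideanSpace ℂ (Bits n × Bits m)) 1 =>
      ∑ y, reduced (ψ : EuclideanSpace ℂ (Bits n × Bits m)) x y * f (Matrix.single x y 1))
      (haarState (Bits n × Bits m)) := fun x => integrable_finsetSum _ fun y _ => hi x y
  have h := integral_re (𝕜 := ℂ) (integrable_finsetSum Finset.univ fun x _ => hs x)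
  simp only [RCLike.re_to_complex] at h
  unfold ghseMean
  rw [hf ((2 ^ n : ℂ)⁻¹ • 1)]
  refine (integral_congr_ae (Filter.Eventually.of_forall
    fun ψ : Metric.sphere (0 : EuclideanSpace ℂ (Bits n × Bits m)) 1 =>
      congrArg Complex.re (hf (reduced (ψ : EuclideanSpace ℂ (Bits n × Bits m)))))).trans ?_
  rw [h, integral_finsetSum _ fun x _ => hs x]
  congr 1
  refine Finset.sum_congr rfl fun x _ => ?_
  rw [integral_finsetSum _ fun y _ => hi x y]
  refine Finset.sum_congr rfl fun y _ => ?_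
  rw [integral_mul_const, integral_reduced]

/-! ### The trace distance of a low-rank state and a highly mixed state -/

theorem re_conjTranspose_mul_self_apply {N : ℕ} (X : QMat N) (i : Bits N) :
    ((X.conjTranspose * X) i i).re = ∑ z, ‖X z i‖ ^ 2 := by
  rw [Matrix.mul_apply, Complex.re_sum]
  refine Finset.sum_congr rfl fun z _ => ?_
  rw [Matrix.conjTranspose_apply, RCLike.star_def, mul_comm, Complex.mul_conj,
    Complex.ofReal_re, Complex.normSq_eq_norm_sq]

/-- Cauchy-Schwarz for the `i`-th columns of `X` and `Y`. -/
theorem re_conjTranspose_mul_apply_le {N : ℕ} (X Y : QMat N) (i : Bits N) :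
    ((X.conjTranspose * Y) i i).re ≤
      √((X.conjTranspose * X) i i).re * √((Y.conjTranspose * Y) i i).re := by
  rw [re_conjTranspose_mul_self_apply, re_conjTranspose_mul_self_apply]
  refine le_trans ?_ (Real.sum_mul_le_sqrt_mul_sqrt Finset.univ (fun z => ‖X z i‖)
    fun z => ‖Y z i‖)
  rw [Matrix.mul_apply, Complex.re_sum]
  refine Finset.sum_le_sum fun z _ => (Complex.re_le_norm _).trans ?_
  rw [norm_mul, Matrix.conjTranspose_apply, norm_star]

/-- In an eigenbasis `V` of `Aᴴ * A`, the trace is the sum of the inner products of the columns of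
`V`, which are unit vectors, with those of `W * A * V`, whose lengths are the singular values of
`A`. -/
theorem re_trace_mul_le_traceNorm {N : ℕ} (A : QMat N) {W : QMat N}
    (hW : W ∈ Matrix.unitaryGroup (Bits N) ℂ) : (W * A).trace.re ≤ traceNorm A := by
  set hH := (Matrix.posSemidef_conjTranspose_mul_self A).isHermitian with hHdef
  set V : QMat N := hH.eigenvectorUnitary.1 with hV
  have hVV : V.conjTranspose * V = 1 := Unitary.coe_star_mul_self hH.eigenvectorUnitary
  have hVV' : V * V.conjTranspose = 1 := Unitary.coe_mul_star_self hH.eigenvectorUnitary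
  have hWW : W.conjTranspose * W = 1 := (Unitary.mem_iff.mp hW).1
  have hdiag : V.conjTranspose * (A.conjTranspose * A) * V =
      Matrix.diagonal (RCLike.ofReal ∘ hH.eigenvalues) := by
    rw [← hH.conjStarAlgAut_star_eigenvectorUnitary, Unitary.conjStarAlgAut_star_apply]
    rfl
  have htr : (W * A).trace = (V.conjTranspose * (W * A * V)).trace := by
    rw [Matrix.trace_mul_comm V.conjTranspose, mul_assoc (W * A), hVV', mul_one]
  have hs : (W * A * V).conjTranspose * (W * A * V) =
      Matrix.diagonal (RCLike.ofReal ∘ hH.eigenvalues) := by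
    rw [← hdiag, Matrix.conjTranspose_mul, Matrix.conjTranspose_mul]
    calc V.conjTranspose * (A.conjTranspose * W.conjTranspose) * (W * A * V)
        = V.conjTranspose * (A.conjTranspose * (W.conjTranspose * W) * A) * V := by
          simp only [mul_assoc]
      _ = _ := by rw [hWW, mul_one]
  rw [htr, Matrix.trace, Complex.re_sum]
  refine Finset.sum_le_sum fun i _ => ?_
  refine (re_conjTranspose_mul_apply_le V (W * A * V) i).trans ?_
  rw [hVV, hs]
  simp

theorem re_trace_mul_nonneg {N : ℕ} {Q M : QMat N} (hQ : Q.IsHermitian) (hQ2 : Q * Q = Q)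
    (hM : M.PosSemidef) : 0 ≤ (Q * M).trace.re := by
  have h := (hM.conjTranspose_mul_mul_same Q).trace_nonneg
  rw [hQ.eq, Matrix.trace_mul_comm, ← mul_assoc, hQ2] at h
  exact (Complex.nonneg_iff.mp h).1

/-- In the spectral decomposition, replace each nonzero eigenvalue by `1`. -/
theorem exists_support_projection {N : ℕ} {A : QMat N} (hA : A.IsHermitian) :
    ∃ Q : QMat N, Q.IsHermitian ∧ Q * Q = Q ∧ Q * A = A ∧ Q.trace = A.rank := by
  set V : QMat N := hA.eigenvectorUnitary.1 with hV
  have hVV : V.conjTranspose * V = 1 := Unitary.coe_star_mul_self hA.eigenvectorUnitary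
  set D : QMat N := Matrix.diagonal fun i => if hA.eigenvalues i ≠ 0 then 1 else 0 with hD
  have hDD : D * D = D := by
    rw [hD, Matrix.diagonal_mul_diagonal]
    congr 1
    ext i
    simp
  have hsp : A = V * Matrix.diagonal (RCLike.ofReal ∘ hA.eigenvalues) * V.conjTranspose := by
    conv_lhs => rw [hA.spectral_theorem, Unitary.conjStarAlgAut_apply]
    rfl
  have hDE : D * Matrix.diagonal (RCLike.ofReal ∘ hA.eigenvalues) =
      Matrix.diagonal (RCLike.ofReal ∘ hA.eigenvalues) := by
    rw [hD, Matrix.diagonal_mul_diagonal]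
    congr 1
    ext i
    by_cases h : hA.eigenvalues i = 0 <;> simp [h]
  have hmul : ∀ X Y : QMat N, (V * X * V.conjTranspose) * (V * Y * V.conjTranspose) =
      V * (X * Y) * V.conjTranspose := by
    intro X Y
    calc _ = V * X * (V.conjTranspose * V) * Y * V.conjTranspose := by simp only [mul_assoc]
      _ = _ := by rw [hVV, mul_one, mul_assoc V]
  refine ⟨V * D * V.conjTranspose, ?_, ?_, ?_, ?_⟩
  · refine Matrix.isHermitian_mul_mul_conjTranspose V ?_
    rw [Matrix.IsHermitian, hD, Matrix.diagonal_conjTranspose]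
    congr 1
    ext i
    simp only [Pi.star_apply]
    split_ifs <;> simp
  · rw [hmul, hDD]
  · conv_lhs => rw [hsp]
    rw [hmul, hDE, ← hsp]
  · rw [Matrix.trace_mul_comm, ← mul_assoc, hVV, one_mul, hA.rank_eq_card_non_zero_eigs, hD,
      Matrix.trace_diagonal, Finset.sum_boole, Fintype.card_subtype]

/-- With `Q` the support projection of `ρ`, the unitary `2 * Q - 1` tests the trace norm: the trace
of `(2 * Q - 1) * (ρ - σ)` is `2 - 2 tr (Q σ)`, and `σ ≤ β I` gives `tr (Q σ) ≤ β tr Q`. -/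
theorem one_sub_le_traceDist {N : ℕ} {ρ σ : QMat N} (hρ : IsDensity ρ) (hσ : σ.trace = 1)
    {β : ℝ} (hβ : ((β : ℂ) • (1 : QMat N) - σ).PosSemidef) :
    1 - β * ρ.rank ≤ traceDist ρ σ := by
  obtain ⟨Q, hQ, hQ2, hQρ, hQt⟩ := exists_support_projection hρ.1.isHermitian
  have hW : (2 * Q - 1) ∈ Matrix.unitaryGroup (Bits N) ℂ := by
    have h1 : star (2 * Q - 1) = 2 * Q - 1 := by
      have : star Q = Q := hQ
      rw [star_sub, star_one, star_mul, star_ofNat, this, mul_two, two_mul]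
    have h2 : (2 * Q - 1) * (2 * Q - 1) = 1 := by
      have : (2 * Q - 1) * (2 * Q - 1) = 4 * (Q * Q) - 4 * Q + 1 := by noncomm_ring
      rw [this, hQ2, sub_self, zero_add]
    rw [Unitary.mem_iff, h1]
    exact ⟨h2, h2⟩
  have h := re_trace_mul_le_traceNorm (ρ - σ) hW
  have hQσ := re_trace_mul_nonneg hQ hQ2 hβ
  have e1 : (2 * Q - 1) * (ρ - σ) = (ρ + σ) - (Q * σ + Q * σ) := by
    have : (2 * Q - 1) * (ρ - σ) = 2 * (Q * ρ) - ρ + σ - 2 * (Q * σ) := by noncomm_ring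
    rw [this, hQρ]
    noncomm_ring
  rw [e1, Matrix.trace_sub, Matrix.trace_add, Matrix.trace_add, hρ.2, hσ] at h
  rw [mul_sub, Matrix.mul_smul, mul_one, Matrix.trace_sub, Matrix.trace_smul, hQt] at hQσ
  simp only [smul_eq_mul, Complex.sub_re, Complex.add_re, Complex.one_re, Complex.mul_re,
    Complex.ofReal_re, Complex.ofReal_im, zero_mul, sub_zero, Complex.natCast_re] at h hQσ
  rw [traceDist]
  linarith

theorem rank_add_le {N : ℕ} (A B : QMat N) : (A + B).rank ≤ A.rank + B.rank := by
  unfold Matrix.rank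
  rw [Matrix.mulVecLin_add]
  refine (Submodule.finrank_mono (LinearMap.range_add_le _ _)).trans
    (Submodule.finrank_add_le_finrank_add_finrank _ _)

theorem rank_sum_le {N : ℕ} {κ : Type*} (s : Finset κ) (A : κ → QMat N) :
    (∑ k ∈ s, A k).rank ≤ ∑ k ∈ s, (A k).rank := by
  classical
  induction s using Finset.induction_on with
  | empty => simp
  | insert k s hk ih =>
    rw [Finset.sum_insert hk, Finset.sum_insert hk]
    exact (rank_add_le _ _).trans (Nat.add_le_add_left ih _)

/-! ### Rotated tag states and their key averages -/

theorem rank_le_of_rotated_tagMixed {n m : ℕ} {U ρ : QMat n} (hρ : ρ.trace = 1)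
    (hU : U ∈ Matrix.unitaryGroup (Bits n) ℂ) (h : ρ = U * tagMixed n m * U.conjTranspose) :
    ρ.rank ≤ 2 ^ m := by
  have hUU : U.conjTranspose * U = 1 := (Unitary.mem_iff.mp hU).1
  have ht : (tagMixed n m).trace = 1 := by
    rw [← hρ, h, Matrix.trace_mul_comm, ← mul_assoc, hUU, one_mul]
  have hr : ρ.rank ≤ (tagMixed n m).rank := by
    rw [h]
    exact (Matrix.rank_mul_le_left _ _).trans (Matrix.rank_mul_le_right _ _)
  refine hr.trans ?_
  rw [tagMixed, Matrix.rank_diagonal, Fintype.card_subtype]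
  rw [tagMixed, Matrix.trace_diagonal, ← Finset.sum_filter, Finset.sum_const, nsmul_eq_mul] at ht
  have h2 : (2 ^ m : ℂ) ≠ 0 := by positivity
  -- Trace `1` with equal weights `2 ^ (-m)` forces exactly `2 ^ m` basis states in the support.
  have hc := (mul_inv_eq_one₀ h2).mp ht
  have hc' : (Finset.univ.filter fun x : Bits n =>
      ∀ i : Fin n, i.val < n - m → x i = false).card = 2 ^ m := by exact_mod_cast hc
  rw [← hc']
  refine Finset.card_le_card fun x hx => ?_
  simp only [Finset.mem_filter, Finset.mem_univ, true_and] at hx ⊢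
  by_contra hcon
  exact hx (if_neg hcon)

/-- The eigenvalues of `tagMixed n m` are `0` or `2 ^ (-m)`, and conjugation by `U` fixes the
identity. -/
theorem posSemidef_sub_rotated_tagMixed {n m : ℕ} {U ρ : QMat n}
    (hU : U ∈ Matrix.unitaryGroup (Bits n) ℂ) (h : ρ = U * tagMixed n m * U.conjTranspose) :
    ((((2 ^ m)⁻¹ : ℝ) : ℂ) • (1 : QMat n) - ρ).PosSemidef := by
  have hUU : U * U.conjTranspose = 1 := (Unitary.mem_iff.mp hU).2
  have h0 : ((((2 ^ m)⁻¹ : ℝ) : ℂ) • (1 : QMat n) - tagMixed n m).PosSemidef := by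
    rw [tagMixed, Matrix.smul_one_eq_diagonal, Matrix.diagonal_sub]
    refine Matrix.PosSemidef.diagonal fun x => ?_
    dsimp only
    split_ifs
    · push_cast
      simp
    · simp
  have := h0.mul_mul_conjTranspose_same U
  rwa [mul_sub, sub_mul, ← h, Matrix.mul_smul, Matrix.smul_mul, mul_one, hUU] at this

theorem isDensity_keyAverage {lam : ℕ → ℕ} {ρ : KeyedFamily lam}
    (h : ∀ n k, IsDensity (ρ n k)) (n : ℕ) : IsDensity (keyAverage ρ n) := by
  constructor
  · refine (Matrix.posSemidef_sum _ fun k _ => (h n k).1).smul ?_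
    positivity
  · rw [keyAverage, Matrix.trace_smul, Matrix.trace_sum, Finset.sum_congr rfl fun k _ => (h n k).2]
    simp

theorem rank_keyAverage_le {lam m : ℕ → ℕ} {ρ : KeyedFamily lam} (h : ∀ n k, IsDensity (ρ n k))
    (hρ : IsRotatedTag m ρ) (n : ℕ) : (keyAverage ρ n).rank ≤ 2 ^ (lam n + m n) := by
  have h2 : (2 ^ lam n : ℂ)⁻¹ ≠ 0 := by positivity
  rw [keyAverage, Matrix.rank_smul_of_mem_nonZeroDivisors _ (mem_nonZeroDivisors_of_ne_zero h2)]
  refine (rank_sum_le _ _).trans ((Finset.sum_le_card_nsmul _ _ (2 ^ m n) fun k _ => ?_).trans ?_)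
  · obtain ⟨U, hU, e⟩ := (hρ n).2 k
    exact rank_le_of_rotated_tagMixed (h n k).2 hU e
  · simp [pow_add]

theorem posSemidef_sub_keyAverage {lam m : ℕ → ℕ} {ρ : KeyedFamily lam}
    (hρ : IsRotatedTag m ρ) (n : ℕ) :
    ((((2 ^ m n)⁻¹ : ℝ) : ℂ) • (1 : QMat n) - keyAverage ρ n).PosSemidef := by
  have h : (((2 ^ m n)⁻¹ : ℝ) : ℂ) • (1 : QMat n) - keyAverage ρ n = (2 ^ lam n : ℂ)⁻¹ •
      ∑ k, ((((2 ^ m n)⁻¹ : ℝ) : ℂ) • (1 : QMat n) - ρ n k) := by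
    have h2 : (2 ^ lam n : ℂ) ≠ 0 := by positivity
    rw [keyAverage, Finset.sum_sub_distrib, smul_sub, Finset.sum_const, Finset.card_univ,
      Fintype.card_pi, Finset.prod_const, Fintype.card_bool, Finset.card_univ, Fintype.card_fin,
      ← Nat.cast_smul_eq_nsmul ℂ, smul_smul]
    push_cast
    rw [inv_mul_cancel₀ h2, one_smul]
  rw [h]
  refine (Matrix.posSemidef_sum _ fun k _ => ?_).smul ?_
  · obtain ⟨U, hU, e⟩ := (hρ n).2 k
    exact posSemidef_sub_rotated_tagMixed hU e
  · positivity

theorem traceDist_keyAverage_ge {lam m₀ m₁ : ℕ → ℕ} {ρ₀ ρ₁ : KeyedFamily lam}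
    (h₀ : ∀ n k, IsDensity (ρ₀ n k)) (h₁ : ∀ n k, IsDensity (ρ₁ n k))
    (hρ₀ : IsRotatedTag m₀ ρ₀) (hρ₁ : IsRotatedTag m₁ ρ₁) {n : ℕ}
    (hn : lam n + m₀ n + 1 ≤ m₁ n) :
    1 / 2 ≤ traceDist (keyAverage ρ₀ n) (keyAverage ρ₁ n) := by
  refine le_trans ?_ (one_sub_le_traceDist (isDensity_keyAverage h₀ n)
    (isDensity_keyAverage h₁ n).2 (posSemidef_sub_keyAverage hρ₁ n))
  have hr : ((keyAverage ρ₀ n).rank : ℝ) ≤ 2 ^ (lam n + m₀ n) := by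
    exact_mod_cast rank_keyAverage_le h₀ hρ₀ n
  -- The spare `1` in `hn` is the factor `2` that yields the bound `1 / 2`.
  have hp : (2 : ℝ) ^ (lam n + m₀ n) * 2 ≤ 2 ^ m₁ n := by
    rw [← pow_succ]
    exact pow_le_pow_right₀ (by norm_num) hn
  have hb : ((2 : ℝ) ^ m₁ n)⁻¹ * (keyAverage ρ₀ n).rank ≤ 1 / 2 := by
    rw [inv_mul_le_iff₀ (by positivity)]
    linarith
  linarith

/-! ### Asymptotics -/

theorem eventually_le_lam {c : ℝ} (hc : 0 < c) {lam : ℕ → ℕ}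
    (hlam : ∀ n : ℕ, |(lam n : ℝ) - c * n| ≤ 1) (K : ℕ) :
    ∀ᶠ n in Filter.atTop, K ≤ lam n := by
  have h := (tendsto_natCast_atTop_atTop (R := ℝ)).const_mul_atTop hc
  filter_upwards [h.eventually_ge_atTop ((K : ℝ) + 1)] with n hn
  have := (abs_le.mp (hlam n)).1
  exact_mod_cast (by linarith : (K : ℝ) ≤ lam n)

theorem Negligible.sub {lam : ℕ → ℕ} (hlam : ∀ᶠ n in Filter.atTop, 2 ≤ lam n) {f g : ℕ → ℝ}
    (hf : Negligible lam f) (hg : Negligible lam g) : Negligible lam fun n => f n - g n := by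
  intro c
  filter_upwards [hlam, hf (c + 1), hg (c + 1)] with n hn h1 h2
  have hn' : (2 : ℝ) ≤ lam n := by exact_mod_cast hn
  -- One extra power of `lam n ≥ 2` absorbs the factor `2` from adding two bounds.
  have h3 : 2 * ((lam n : ℝ) ^ (c + 1))⁻¹ ≤ ((lam n : ℝ) ^ c)⁻¹ := by
    rw [pow_succ, mul_inv, mul_comm, mul_assoc]
    refine mul_le_of_le_one_right (by positivity) ?_
    rw [inv_mul_le_iff₀ (by linarith)]
    linarith
  have := abs_sub (f n) (g n)
  linarith

theorem eventually_add_lt {c γ : ℝ} (hcγ : c < γ) {lam m₀ m₁ : ℕ → ℕ}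
    (hlam : ∀ n : ℕ, |(lam n : ℝ) - c * n| ≤ 1)
    (hm₀ : ∃ d : ℕ, Asymptotics.IsBigO Filter.atTop (fun n : ℕ => (m₀ n : ℝ))
      (fun n : ℕ => Real.log n ^ d))
    (hm₁ : ∀ n : ℕ, |(m₁ n : ℝ) - γ * n| ≤ 1) :
    ∀ᶠ n in Filter.atTop, lam n + m₀ n + 1 ≤ m₁ n := by
  obtain ⟨d, hd⟩ := hm₀
  have ho : (fun n : ℕ => (m₀ n : ℝ)) =o[Filter.atTop] fun n : ℕ => (n : ℝ) :=
    hd.trans_isLittleO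
      ((Real.isLittleO_pow_log_id_atTop (n := d)).comp_tendsto tendsto_natCast_atTop_atTop)
  -- Half of the gap `(γ - c) * n` dominates `m₀ n`; the other half exceeds `3`, which covers two
  -- rounding errors and the extra `1`.
  have hδ : 0 < (γ - c) / 2 := by linarith
  have h := (tendsto_natCast_atTop_atTop (R := ℝ)).const_mul_atTop hδ
  filter_upwards [ho.bound hδ, h.eventually_ge_atTop 3] with n h1 h2
  have h3 := (abs_le.mp (hlam n)).2
  have h4 := (abs_le.mp (hm₁ n)).1
  rw [Real.norm_natCast, Real.norm_natCast] at h1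
  have : (lam n : ℝ) + m₀ n + 1 ≤ m₁ n := by linarith
  exact_mod_cast this

/-- One copy of a VPRDM state with unknown key looks maximally mixed. -/
theorem IsVPRDM.negligible_accept_sub {lam m : ℕ → ℕ} {ρ : KeyedFamily lam}
    (h : IsVPRDM lam m ρ) {A : ℕ → Circuit} (hA : IsQPT (fun n => [n, lam n]) A) :
    Negligible lam fun n =>
      accept (A n) (keyAverage ρ n) - accept (A n) ((2 ^ n : ℂ)⁻¹ • (1 : QMat n)) := by
  have h1 := h.pseudorandom (fun _ => 1) ⟨1, fun n => by simp⟩ A hA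
  have e : ∀ n, accept (A n) (keyAverage ρ n) - accept (A n) ((2 ^ n : ℂ)⁻¹ • (1 : QMat n)) =
      keyMean (fun k => accept (A n) (copies 1 (ρ n k))) -
        ghseMean n (m n) fun σ => accept (A n) (copies 1 σ) := by
    intro n
    simp only [accept_copies_one, accept_keyAverage]
    rw [accept_eq_re _ ((2 ^ n : ℂ)⁻¹ • (1 : QMat n)), ← ghseMean_linear n (m n)]
    rfl
  simpa only [e] using h1

theorem isEFIPair_keyAverage {lam m₀ m₁ : ℕ → ℕ} {ρ : Bool → KeyedFamily lam}
    (hlam : ∀ K, ∀ᶠ n in Filter.atTop, K ≤ lam n)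
    (hm : ∀ᶠ n in Filter.atTop, lam n + m₀ n + 1 ≤ m₁ n)
    (h₀ : IsVPRDM lam m₀ (ρ false)) (h₁ : IsVPRDM lam m₁ (ρ true))
    (hρ₀ : IsRotatedTag m₀ (ρ false)) (hρ₁ : IsRotatedTag m₁ (ρ true)) :
    IsEFIPair lam fun b => keyAverage (ρ b) where
  density b n := by
    cases b
    · exact isDensity_keyAverage h₀.density n
    · exact isDensity_keyAverage h₁.density n
  efficient := by
    have hG : ∀ b, ∃ G : ℕ → Circuit, IsQPT (fun n => [n, lam n]) G ∧
        ∀ n k, applyCircuit (G n) n (ketbra k) = ρ b n k := by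
      intro b
      cases b
      · exact h₀.preparable
      · exact h₁.preparable
    choose G hG hGρ using hG
    refine ⟨fun i => coinCircuit (lam i.2) ++ G i.1 i.2,
      IsQPT.select fun b => (hG b).coinCircuit_append, fun b n => ?_⟩
    simp only [applyCircuit_coinCircuit_append, hGρ, keyAverage]
  far := by
    -- The distance is at least the constant `1 / 2`, so `d = 1` suffices once `lam n ≥ 2`.
    refine ⟨1, ?_⟩
    filter_upwards [hlam 2, hm] with n h2 hn
    refine le_trans ?_ (traceDist_keyAverage_ge h₀.density h₁.density hρ₀ hρ₁ hn)
    rw [pow_one, one_div]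
    exact inv_anti₀ (by norm_num) (by exact_mod_cast h2)
  indistinguishable A hA := by
    -- The maximally mixed state is common to both differences and cancels.
    have h := (h₀.negligible_accept_sub hA).sub (hlam 2) (h₁.negligible_accept_sub hA)
    simpa only [sub_sub_sub_cancel_right] using h

end QPT
end

theorem mainTheorem6 (c γ : ℝ) (hc : 0 < c) (hγ₀ : 0 < γ) (hγ₁ : γ < 1) (hcγ : c < γ)
    (lam m₀ m₁ : ℕ → ℕ)
    (hlam : ∀ n : ℕ, |(lam n : ℝ) - c * n| ≤ 1)
    (hm₀ : ∃ d : ℕ, Asymptotics.IsBigO Filter.atTop (fun n : ℕ => (m₀ n : ℝ))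
      (fun n : ℕ => Real.log n ^ d))
    (hm₁ : ∀ n : ℕ, |(m₁ n : ℝ) - γ * n| ≤ 1)
    (ρ₀ ρ₁ : QPT.KeyedFamily lam)
    (h₀ : QPT.IsVPRDM lam m₀ ρ₀) (h₁ : QPT.IsVPRDM lam m₁ ρ₁)
    (hρ₀ : QPT.IsRotatedTag m₀ ρ₀) (hρ₁ : QPT.IsRotatedTag m₁ ρ₁) :
    QPT.IsVerifiableEFIPair lam (fun b => if b = true then ρ₁ else ρ₀) := by
  refine ⟨QPT.isEFIPair_keyAverage (m₀ := m₀) (m₁ := m₁) (QPT.eventually_le_lam hc hlam)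
    (QPT.eventually_add_lt hcγ hlam hm₀ hm₁) h₀ h₁ hρ₀ hρ₁, ?_⟩
  obtain ⟨V₀, hV₀, hv₀⟩ := h₀.verifiable
  obtain ⟨V₁, hV₁, hv₁⟩ := h₁.verifiable
  refine ⟨fun i => (if i.1 = true then V₁ else V₀) i.2,
    QPT.IsQPT.select (C := fun b => if b = true then V₁ else V₀) fun b => ?_, fun b => ?_⟩
  · cases b
    · exact hV₀
    · exact hV₁
  · cases b
    · exact hv₀
    · exact hv₁
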